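/- Let $\mathbb{K}$ be a (commutative) field with at least three elements and let $n \geq 1$ be an integer. Let $\mathrm{A}_n(\mathbb{K})$ denote the set of alternate matrices of $\mathrm{M}_n(\mathbb{K})$, i.e. of the matrices $A$ such that $X^TAX=0$ for all $X \in \mathbb{K}^n$. Let $P \in \mathrm{GL}_n(\mathbb{K})$ be non-isotropic, i.e. $X^TPX \neq 0$ for all $X \in \mathbb{K}^n \setminus \{0\}$, and set $\mathcal{W} := I_n + P\,\mathrm{A}_n(\mathbb{K}) = \{I_n+PA \mid A \in \mathrm{A}_n(\mathbb{K})\}$. Let $\mathcal{V}$ be an affine subspace of the space $\mathrm{M}_{n+1,n}(\mathbb{K})$ of all $(n+1)\times n$ matrices, with codimension $\binom{n+1}{2}$, in which every matrix has rank $n$, and which contains $\begin{bmatrix} M \\ 0 \end{bmatrix}$ for every $M \in \mathcal{W}$. Then there is a list $(\lambda_1,\dots,\lambda_n) \in \mathbb{K}^n$ such that the series of row operations $L_i \leftarrow L_i + \lambda_i L_{n+1}$, for $i$ from $1$ to $n$, transforms $\mathcal{V}$ into the set $$i_{n+1,n}(\mathcal{W}) := \left\{\begin{bmatrix} M \\ L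 \end{bmatrix} \;\middle|\; M \in \mathcal{W},\ L \in \mathrm{M}_{1,n}(\mathbb{K})\right\}.$$ -/

import Mathlib

/-- Alternate matrices: square matrices `A` such that `Xᵀ A X = 0` for every column `X`. -/
def alternateMatrices (n : ℕ) (K : Type*) [Field K] : Set (Matrix (Fin n) (Fin n) K) :=
  {A | ∀ X : Fin n → K, dotProduct X (A.mulVec X) = 0}

/-- A square matrix `P` is non-isotropic when `Xᵀ P X ≠ 0` for every non-zero column `X`. -/
def IsNonIsotropic {n : ℕ} {K : Type*} [Field K] (P : Matrix (Fin n) (Fin n) K) : Prop :=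
  ∀ X : Fin n → K, X ≠ 0 → dotProduct X (P.mulVec X) ≠ 0

/-- The set `I_n + P A_n(K)`. -/
def onePlusMulAlternate {n : ℕ} {K : Type*} [Field K] (P : Matrix (Fin n) (Fin n) K) :
    Set (Matrix (Fin n) (Fin n) K) :=
  {M | ∃ A ∈ alternateMatrices n K, M = 1 + P * A}

/-- `i_{n,p}(𝒳)`: the `n × p` matrices whose upper-left `r × r` block belongs to `𝒳`,
the other entries being arbitrary. -/
def bordered {r n p : ℕ} {K : Type*} (hn : r ≤ n) (hp : r ≤ p)
    (X : Set (Matrix (Fin r) (Fin r) K)) : Set (Matrix (Fin n) (Fin p) K) :=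
  {M | M.submatrix (Fin.castLE hn) (Fin.castLE hp) ∈ X}

/-- The `(n+1) × n` matrix obtained from the `n × n` matrix `M` by adding a zero row at the
bottom. -/
def appendZeroRow {n : ℕ} {K : Type*} [Field K] (M : Matrix (Fin n) (Fin n) K) :
    Matrix (Fin (n + 1)) (Fin n) K :=
  Matrix.of (Fin.snoc (α := fun _ => Fin n → K) (fun i => M i) (fun _ => 0))

/-- The row operations `L_i ← L_i + c_i L_{n+1}`, for `i` from `1` to `n`. As none of them
changes the last row, they may be performed simultaneously. -/
def addLastRow {n : ℕ} {K : Type*} [Field K] (c : Fin n → K)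
    (M : Matrix (Fin (n + 1)) (Fin n) K) : Matrix (Fin (n + 1)) (Fin n) K :=
  Matrix.of (Fin.snoc (α := fun _ => Fin n → K)
    (fun i => M i.castSucc + c i • M (Fin.last n)) (M (Fin.last n)))

open Matrix Module

/-! ### Alternate matrices and the quadratic forms they annihilate. -/

section Alternate

variable {K : Type*} [Field K] {n : ℕ}

/-! Let `D` lie in the direction of `V`, with last row `L` and upper block `T`. If `L` kills `X`,
then the quadratic form of `P⁻¹ T` vanishes at `X`: otherwise some `I + P A + t T` would kill `X`,
against the rank condition (`direction_isotropic`). So `L = 0` makes `P⁻¹ T` alternate, and counting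
dimensions shows that every `L` occurs (`exists_direction_lastRow_eq`). Lifting the standard basis
of last rows gives forms `q i` whose vector of values at `X` is orthogonal to `X^⊥`, hence collinear
with `X`. As `K` has a third element, this forces `q i X = X i * (d ⬝ᵥ X)` with one `d` for all `i`
(`exists_common_linear_factor`). Thus `P⁻¹ T - d L` is always alternate, and the row operations with
coefficients `-P d` absorb the term `d L`. -/

theorem alternate_diag {A : Matrix (Fin n) (Fin n) K} (hA : A ∈ alternateMatrices n K)
    (i : Fin n) : A i i = 0 := by
  simpa using hA (Pi.single i 1)

theorem single_add_single_dotProduct_mulVec (A : Matrix (Fin n) (Fin n) K) (i j : Fin n)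
    (x y : K) :
    (Pi.single i x + Pi.single j y) ⬝ᵥ (A *ᵥ (Pi.single i x + Pi.single j y)) =
      A i i * x ^ 2 + (A i j + A j i) * (x * y) + A j j * y ^ 2 := by
  simp [Matrix.mulVec_add, add_dotProduct]
  ring

theorem alternate_add_swap {A : Matrix (Fin n) (Fin n) K} (hA : A ∈ alternateMatrices n K)
    (i j : Fin n) : A i j + A j i = 0 := by
  have h := hA (Pi.single i 1 + Pi.single j 1)
  rw [single_add_single_dotProduct_mulVec, alternate_diag hA, alternate_diag hA] at h
  simpa using h

theorem sub_transpose_mem_alternate (B : Matrix (Fin n) (Fin n) K) :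
    B - Bᵀ ∈ alternateMatrices n K := by
  intro X
  rw [sub_mulVec, dotProduct_sub, mulVec_transpose, dotProduct_comm X (X ᵥ* B),
    dotProduct_mulVec, sub_self]

theorem mem_alternate_of_entries {A : Matrix (Fin n) (Fin n) K} (hd : ∀ i, A i i = 0)
    (hs : ∀ i j, i ≠ j → A i j + A j i = 0) : A ∈ alternateMatrices n K := by
  have h : A = (of fun i j => if i < j then A i j else 0) -
      (of fun i j => if i < j then A i j else 0)ᵀ := by
    ext i j
    rcases lt_trichotomy i j with hij | rfl | hij
    · simp [hij, hij.not_gt]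
    · simp [hd]
    · simp [hij, hij.not_gt, eq_neg_of_add_eq_zero_left (hs i j hij.ne')]
  rw [h]
  exact sub_transpose_mem_alternate _

theorem add_mem_alternate {A B : Matrix (Fin n) (Fin n) K} (hA : A ∈ alternateMatrices n K)
    (hB : B ∈ alternateMatrices n K) : A + B ∈ alternateMatrices n K := by
  intro X
  rw [add_mulVec, dotProduct_add, hA X, hB X, add_zero]

theorem smul_mem_alternate {A : Matrix (Fin n) (Fin n) K} (c : K)
    (hA : A ∈ alternateMatrices n K) : c • A ∈ alternateMatrices n K := by
  intro X
  rw [smul_mulVec, dotProduct_smul, hA X, smul_zero]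

theorem zero_mem_alternate : (0 : Matrix (Fin n) (Fin n) K) ∈ alternateMatrices n K := by
  intro X
  simp

theorem sum_mem_alternate {ι : Type*} (s : Finset ι) (A : ι → Matrix (Fin n) (Fin n) K)
    (hA : ∀ i ∈ s, A i ∈ alternateMatrices n K) : ∑ i ∈ s, A i ∈ alternateMatrices n K :=
  Finset.sum_induction A (· ∈ alternateMatrices n K) (fun _ _ => add_mem_alternate)
    zero_mem_alternate hA

/-- Alternate matrices map a non-zero vector `X` onto all of its orthogonal. -/
theorem exists_alternate_mulVec_eq {X Y : Fin n → K} (hX : X ≠ 0) (hXY : X ⬝ᵥ Y = 0) :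
    ∃ A ∈ alternateMatrices n K, A *ᵥ X = Y := by
  obtain ⟨k, hk⟩ := Function.ne_iff.mp hX
  -- With `u ⬝ᵥ X = 1`, the matrix `Y uᵀ - u Yᵀ` sends `X` to `Y - (Y ⬝ᵥ X) u = Y`.
  refine ⟨vecMulVec Y (Pi.single k (X k)⁻¹) - (vecMulVec Y (Pi.single k (X k)⁻¹))ᵀ,
    sub_transpose_mem_alternate _, ?_⟩
  have hk' : X k ≠ 0 := hk
  rw [transpose_vecMulVec, sub_mulVec, vecMulVec_mulVec, vecMulVec_mulVec,
    dotProduct_comm Y X, hXY]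
  simp [hk']

/-- Quadratic forms `q i` such that `∑ i, l i * q i X` vanishes whenever `∑ i, l i * X i` does
are the products of the coordinates with one common linear form. -/
theorem exists_common_linear_factor (hK : 3 ≤ ENat.card K)
    (Q : Fin n → Matrix (Fin n) (Fin n) K)
    (hQ : ∀ l X : Fin n → K, l ⬝ᵥ X = 0 → ∑ i, l i * (X ⬝ᵥ (Q i *ᵥ X)) = 0) :
    ∃ d : Fin n → K, ∀ i, Q i - vecMulVec d (Pi.single i 1) ∈ alternateMatrices n K := by
  obtain ⟨a, ha0, ha1⟩ : ∃ a : K, a ≠ 0 ∧ a ≠ 1 := by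
    by_contra! h
    have hsub : (Set.univ : Set K) ⊆ {0, 1} := fun x _ => by
      by_cases hx : x = 0
      · simp [hx]
      · simp [h x hx]
    have h1 := Set.encard_le_encard hsub
    rw [Set.encard_univ] at h1
    have h2 := (hK.trans h1).trans (Set.encard_insert_le _ _)
    rw [Set.encard_singleton] at h2
    exact absurd h2 (by decide)
  have hvan : ∀ i X, X i = 0 → X ⬝ᵥ (Q i *ᵥ X) = 0 := fun i X hX => by
    simpa [Pi.single_apply] using hQ (Pi.single i 1) X (by simpa using hX)
  have hdiag : ∀ i k, i ≠ k → Q i k k = 0 := fun i k hik => by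
    simpa using hvan i (Pi.single k 1) (by simp [hik])
  have hmixed : ∀ i k, i ≠ k → Q i i k + Q i k i = Q k k k := fun i k hik => by
    have key : ∀ y : K, y ≠ 0 →
        Q i i i + (Q i i k + Q i k i) * y = (Q k i k + Q k k i) + Q k k k * y := fun y hy => by
      -- Evaluation at `e_i + y e_k`, against the orthogonal vector `y e_i - e_k`.
      have h := hQ (Pi.single i y - Pi.single k 1) (Pi.single i 1 + Pi.single k y)
        (by simp [hik, hik.symm])
      simp only [single_add_single_dotProduct_mulVec, Pi.sub_apply, sub_mul,
        Finset.sum_sub_distrib, Pi.single_apply, ite_mul, zero_mul, Finset.sum_ite_eq',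
        Finset.mem_univ, if_true, hdiag i k hik, hdiag k i hik.symm] at h
      refine mul_left_cancel₀ hy ?_
      linear_combination h
    -- Two affine functions of `y` agreeing at `1` and at `a ≠ 1` have equal slopes; a two-element
    -- field offers only `y = 1`.
    refine mul_left_cancel₀ (sub_ne_zero.mpr ha1) ?_
    linear_combination key a ha0 - key 1 one_ne_zero
  -- If `q k X = X k * (d ⬝ᵥ X)`, then `d k` is the coefficient of `X k ^ 2` in `q k`.
  refine ⟨fun k => Q k k k, fun i => mem_alternate_of_entries (fun j => ?_) fun j k hjk => ?_⟩
  · by_cases hj : j = i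
    · subst hj; simp [vecMulVec_apply]
    · simp [vecMulVec_apply, hj, hdiag i j (Ne.symm hj)]
  · by_cases hj : j = i
    · subst hj
      simp only [Matrix.sub_apply, vecMulVec_apply, Pi.single_eq_same, Pi.single_eq_of_ne hjk.symm]
      linear_combination hmixed j k hjk
    · by_cases hk : k = i
      · subst hk
        simp only [Matrix.sub_apply, vecMulVec_apply, Pi.single_eq_same, Pi.single_eq_of_ne hj]
        linear_combination hmixed k j hjk.symm
      · have h := hvan i (Pi.single j 1 + Pi.single k 1) (by simp [Ne.symm hj, Ne.symm hk])
        rw [single_add_single_dotProduct_mulVec, hdiag i j (Ne.symm hj),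
          hdiag i k (Ne.symm hk)] at h
        simpa [vecMulVec_apply, hj, hk] using h

end Alternate

/-! ### Splitting a matrix into upper block and last row. -/

section Rows

variable {K : Type*} [Field K] {n : ℕ}

/-- The matrix obtained by deleting the last row. -/
def dropLastRow : Matrix (Fin (n + 1)) (Fin n) K →ₗ[K] Matrix (Fin n) (Fin n) K where
  toFun M := of fun i j => M i.castSucc j
  map_add' _ _ := rfl
  map_smul' _ _ := rfl

/-- The last row, as a vector. -/
def lastRow : Matrix (Fin (n + 1)) (Fin n) K →ₗ[K] (Fin n → K) where
  toFun M := M (Fin.last n)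
  map_add' _ _ := rfl
  map_smul' _ _ := rfl

theorem dropLastRow_apply (M : Matrix (Fin (n + 1)) (Fin n) K) (i j : Fin n) :
    dropLastRow M i j = M i.castSucc j := rfl

theorem lastRow_apply (M : Matrix (Fin (n + 1)) (Fin n) K) (j : Fin n) :
    lastRow M j = M (Fin.last n) j := rfl

theorem ext_rows {M N : Matrix (Fin (n + 1)) (Fin n) K} (h : dropLastRow M = dropLastRow N)
    (h' : lastRow M = lastRow N) : M = N := by
  ext i j
  induction i using Fin.lastCases with
  | last => exact congrFun h' j
  | cast i => exact congrFun (congrFun h i) j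

@[simp] theorem dropLastRow_appendZeroRow (M : Matrix (Fin n) (Fin n) K) :
    dropLastRow (appendZeroRow M) = M := by
  ext i j
  simp [dropLastRow_apply, appendZeroRow]

@[simp] theorem lastRow_appendZeroRow (M : Matrix (Fin n) (Fin n) K) :
    lastRow (appendZeroRow M) = 0 := by
  ext j
  simp [lastRow_apply, appendZeroRow]

@[simp] theorem dropLastRow_addLastRow (c : Fin n → K) (M : Matrix (Fin (n + 1)) (Fin n) K) :
    dropLastRow (addLastRow c M) = dropLastRow M + vecMulVec c (lastRow M) := by
  ext i j
  simp [dropLastRow_apply, addLastRow, lastRow_apply, vecMulVec_apply]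

@[simp] theorem lastRow_addLastRow (c : Fin n → K) (M : Matrix (Fin (n + 1)) (Fin n) K) :
    lastRow (addLastRow c M) = lastRow M := by
  ext j
  simp [lastRow_apply, addLastRow]

theorem mem_bordered_iff {S : Set (Matrix (Fin n) (Fin n) K)}
    {M : Matrix (Fin (n + 1)) (Fin n) K} :
    M ∈ bordered (Nat.le_succ n) le_rfl S ↔ dropLastRow M ∈ S := Iff.rfl

theorem mulVec_eq_zero_of_rows {M : Matrix (Fin (n + 1)) (Fin n) K} {X : Fin n → K}
    (h : dropLastRow M *ᵥ X = 0) (h' : lastRow M ⬝ᵥ X = 0) : M *ᵥ X = 0 := by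
  ext i
  induction i using Fin.lastCases with
  | last => exact h'
  | cast i => exact congrFun h i

theorem eq_zero_of_mulVec_eq_zero_of_rank_eq {m : Type*} [Fintype m]
    {M : Matrix m (Fin n) K} (hM : M.rank = n) {X : Fin n → K} (h : M *ᵥ X = 0) : X = 0 := by
  have h1 := LinearMap.finrank_range_add_finrank_ker M.mulVecLin
  rw [show finrank K (LinearMap.range M.mulVecLin) = n from hM, finrank_fin_fun] at h1
  have h2 : LinearMap.ker M.mulVecLin = ⊥ := Submodule.finrank_eq_zero.mp (by omega)
  have h3 : X ∈ LinearMap.ker M.mulVecLin := by simpa using h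
  simpa [h2] using h3

end Rows

/-! ### The direction of the affine space. -/

section Direction

variable {K : Type*} [Field K] {n : ℕ} {P : GL (Fin n) K}
  {V : AffineSubspace K (Matrix (Fin (n + 1)) (Fin n) K)}

theorem GL.mul_inv_mul_matrix (P : GL (Fin n) K) (M : Matrix (Fin n) (Fin n) K) :
    (P : Matrix (Fin n) (Fin n) K) * ((P⁻¹ : GL (Fin n) K).val * M) = M := by
  rw [← Matrix.mul_assoc, ← Units.val_mul, mul_inv_cancel, Units.val_one, Matrix.one_mul]

theorem IsNonIsotropic.inv (hP : IsNonIsotropic (P : Matrix (Fin n) (Fin n) K)) :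
    IsNonIsotropic ((P⁻¹ : GL (Fin n) K) : Matrix (Fin n) (Fin n) K) := by
  intro X hX h
  have hPX : (P : Matrix (Fin n) (Fin n) K) *ᵥ ((P⁻¹ : GL (Fin n) K).val *ᵥ X) = X := by
    rw [mulVec_mulVec, ← Units.val_mul, mul_inv_cancel, Units.val_one, one_mulVec]
  refine hP ((P⁻¹ : GL (Fin n) K).val *ᵥ X) (fun h0 => hX ?_) ?_
  · rw [← hPX, h0, mulVec_zero]
  · rw [hPX, dotProduct_comm, h]

theorem direction_isotropic (hP : IsNonIsotropic (P : Matrix (Fin n) (Fin n) K))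
    (hrank : ∀ M ∈ V, M.rank = n)
    (hcore : ∀ M ∈ onePlusMulAlternate (P : Matrix (Fin n) (Fin n) K), appendZeroRow M ∈ V)
    {D : Matrix (Fin (n + 1)) (Fin n) K} (hD : D ∈ V.direction) {X : Fin n → K}
    (hX : lastRow D ⬝ᵥ X = 0) :
    X ⬝ᵥ (((P⁻¹ : GL (Fin n) K).val * dropLastRow D) *ᵥ X) = 0 := by
  by_contra hq
  have hX0 : X ≠ 0 := by
    rintro rfl
    simp at hq
  set R := (P⁻¹ : GL (Fin n) K).val with hR
  -- This `t` makes `(R + t R T) X` orthogonal to `X`, `T` being the upper block of `D`, so that an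
  -- alternate `A` can cancel it; it is non-zero because `P⁻¹` is non-isotropic.
  set t : K := -(X ⬝ᵥ (R *ᵥ X)) / (X ⬝ᵥ ((R * dropLastRow D) *ᵥ X)) with ht
  have ht0 : t ≠ 0 := div_ne_zero (neg_ne_zero.mpr (hP.inv X hX0)) hq
  obtain ⟨A, hA, hAX⟩ := exists_alternate_mulVec_eq (Y := -((R + t • (R * dropLastRow D)) *ᵥ X))
    hX0 (by
      rw [dotProduct_neg, add_mulVec, dotProduct_add, smul_mulVec, dotProduct_smul, smul_eq_mul,
        ht, div_mul_cancel₀ _ hq, add_neg_cancel, neg_zero])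
  have hmem := AffineSubspace.vadd_mem_of_mem_direction (V.direction.smul_mem t hD)
    (hcore _ ⟨A, hA, rfl⟩)
  rw [vadd_eq_add] at hmem
  refine hX0 (eq_zero_of_mulVec_eq_zero_of_rank_eq (hrank _ hmem) (mulVec_eq_zero_of_rows ?_ ?_))
  · have h1 : (P : Matrix (Fin n) (Fin n) K) * R = 1 := by
      rw [hR, ← Units.val_mul, mul_inv_cancel, Units.val_one]
    rw [map_add, map_smul, dropLastRow_appendZeroRow, add_mulVec, add_mulVec, ← mulVec_mulVec _ _ A,
      hAX, mulVec_neg, mulVec_mulVec, Matrix.mul_add, h1, Matrix.mul_smul, hR,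
      GL.mul_inv_mul_matrix, add_mulVec, one_mulVec]
    abel
  · rw [map_add, map_smul, lastRow_appendZeroRow, add_zero, smul_dotProduct, hX, smul_zero]

/-- The direction has dimension `n (n + 1) - (n + 1).choose 2 = n + n.choose 2`, and its elements
with zero last row account for at most `n.choose 2`. -/
theorem exists_direction_lastRow_eq (hP : IsNonIsotropic (P : Matrix (Fin n) (Fin n) K))
    (hcodim : finrank K (Matrix (Fin (n + 1)) (Fin n) K ⧸ V.direction) = (n + 1).choose 2)
    (hrank : ∀ M ∈ V, M.rank = n)
    (hcore : ∀ M ∈ onePlusMulAlternate (P : Matrix (Fin n) (Fin n) K), appendZeroRow M ∈ V)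
    (L : Fin n → K) : ∃ D ∈ V.direction, lastRow D = L := by
  let f : V.direction →ₗ[K] (Fin n → K) := lastRow ∘ₗ V.direction.subtype
  -- The entries strictly above the diagonal, which determine an alternate matrix.
  let g : LinearMap.ker f →ₗ[K] ((Σ j : Fin n, Fin j) → K) :=
    { toFun := fun D p =>
        ((P⁻¹ : GL (Fin n) K).val * dropLastRow D.1.1) (Fin.castLE p.1.2.le p.2) p.1
      map_add' := fun D E => by ext; simp [Matrix.mul_add]
      map_smul' := fun c D => by ext; simp }
  have hg : Function.Injective g := by
    suffices hker : ∀ D, g D = 0 → D = 0 from fun D E h =>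
      sub_eq_zero.mp (hker (D - E) ((g.map_sub D E).trans (sub_eq_zero.mpr h)))
    intro D hD
    have hlast : lastRow D.1.1 = 0 := D.2
    have halt : (P⁻¹ : GL (Fin n) K).val * dropLastRow D.1.1 ∈ alternateMatrices n K := fun X =>
      direction_isotropic hP hrank hcore D.1.2 (by rw [hlast, zero_dotProduct])
    have hlt : ∀ i j : Fin n, i < j →
        ((P⁻¹ : GL (Fin n) K).val * dropLastRow D.1.1) i j = 0 := fun i j hij =>
      congrFun hD ⟨j, ⟨i, hij⟩⟩
    have hzero : (P⁻¹ : GL (Fin n) K).val * dropLastRow D.1.1 = 0 := by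
      ext i j
      rcases lt_trichotomy i j with hij | rfl | hij
      · exact hlt i j hij
      · exact alternate_diag halt i
      · have h := alternate_add_swap halt i j
        rwa [hlt j i hij, add_zero] at h
    refine Subtype.ext (Subtype.ext (ext_rows ?_ ?_))
    · rw [← GL.mul_inv_mul_matrix P (dropLastRow D.1.1), hzero, Matrix.mul_zero]
      rfl
    · exact hlast
  have h1 := LinearMap.finrank_le_finrank_of_injective hg
  rw [finrank_fintype_fun_eq_card, Fintype.card_sigma] at h1
  simp only [Fintype.card_fin] at h1
  rw [Fin.sum_univ_eq_sum_range (fun i => i), Finset.sum_range_id, ← Nat.choose_two_right] at h1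
  have h2 := LinearMap.finrank_range_add_finrank_ker f
  have h3 := V.direction.finrank_quotient_add_finrank
  rw [hcodim, finrank_matrix, finrank_self, Fintype.card_fin, Fintype.card_fin, mul_one] at h3
  have h4 : (n + 1).choose 2 = n + n.choose 2 := by
    rw [Nat.choose_succ_succ' n 1, Nat.choose_one_right]
  have h5 : (n + 1).choose 2 + (n + 1).choose 2 = (n + 1) * n := by
    rw [← mul_two, Nat.choose_two_right, Nat.add_sub_cancel]
    exact Nat.div_mul_cancel (Nat.even_mul_pred_self (n + 1)).two_dvd
  have h6 : LinearMap.range f = ⊤ := by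
    refine Submodule.eq_top_of_finrank_eq (le_antisymm (Submodule.finrank_le _) ?_)
    rw [finrank_fin_fun]
    omega
  obtain ⟨D, hD⟩ := LinearMap.range_eq_top.mp h6 L
  exact ⟨D.1, D.2, hD⟩

/-- Up to a rank-one correction, the upper blocks of the matrices of the direction lie in
`P A_n(K)`. -/
theorem exists_direction_correction (hK : 3 ≤ ENat.card K)
    (hP : IsNonIsotropic (P : Matrix (Fin n) (Fin n) K))
    (hcodim : finrank K (Matrix (Fin (n + 1)) (Fin n) K ⧸ V.direction) = (n + 1).choose 2)
    (hrank : ∀ M ∈ V, M.rank = n)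
    (hcore : ∀ M ∈ onePlusMulAlternate (P : Matrix (Fin n) (Fin n) K), appendZeroRow M ∈ V) :
    ∃ d : Fin n → K, ∀ D ∈ V.direction,
      (P⁻¹ : GL (Fin n) K).val * dropLastRow D - vecMulVec d (lastRow D) ∈
        alternateMatrices n K := by
  choose B hB hBlast using fun i : Fin n =>
    exists_direction_lastRow_eq hP hcodim hrank hcore (Pi.single i 1)
  have hlast : ∀ l : Fin n → K, lastRow (∑ i, l i • B i) = l := fun l => by
    ext j
    simp [map_sum, hBlast, Finset.sum_apply, Pi.single_apply]
  have hmem : ∀ l : Fin n → K, ∑ i, l i • B i ∈ V.direction := fun l =>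
    Submodule.sum_mem _ fun i _ => V.direction.smul_mem _ (hB i)
  obtain ⟨d, hd⟩ := exists_common_linear_factor hK
    (fun i => (P⁻¹ : GL (Fin n) K).val * dropLastRow (B i)) (fun l X hlX => by
      have h := direction_isotropic hP hrank hcore (hmem l) (X := X) (by rw [hlast, hlX])
      simpa only [map_sum, map_smul, Matrix.mul_sum, Matrix.mul_smul, Matrix.sum_mulVec,
        smul_mulVec, dotProduct_sum, dotProduct_smul, smul_eq_mul] using h)
  refine ⟨d, fun D hD => ?_⟩
  set l := lastRow D with hl
  have hE : (P⁻¹ : GL (Fin n) K).val * dropLastRow (D - ∑ i, l i • B i) ∈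
      alternateMatrices n K := fun X =>
    direction_isotropic hP hrank hcore (V.direction.sub_mem hD (hmem l))
      (by rw [map_sub, hlast, ← hl, sub_self, zero_dotProduct])
  have hS := sum_mem_alternate Finset.univ _ fun i _ => smul_mem_alternate (l i) (hd i)
  have hvec : vecMulVec d l = ∑ i, l i • vecMulVec d (Pi.single i 1) := by
    ext a b
    simp [Matrix.sum_apply, vecMulVec_apply, Pi.single_apply, mul_comm]
  convert add_mem_alternate hE hS using 1
  simp only [hvec, map_sub, map_sum, map_smul, Matrix.mul_sub, Matrix.mul_sum, Matrix.mul_smul,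
    smul_sub, Finset.sum_sub_distrib]
  abel

end Direction

theorem proposition2 {K : Type*} [Field K] (hK : 3 ≤ ENat.card K) (n : ℕ) (hn : 1 ≤ n)
    (P : GL (Fin n) K) (hP : IsNonIsotropic (P : Matrix (Fin n) (Fin n) K))
    (V : AffineSubspace K (Matrix (Fin (n + 1)) (Fin n) K))
    (hcodim : Module.finrank K (Matrix (Fin (n + 1)) (Fin n) K ⧸ V.direction) = (n + 1).choose 2)
    (hrank : ∀ M ∈ V, M.rank = n)
    (hcore : ∀ M ∈ onePlusMulAlternate (P : Matrix (Fin n) (Fin n) K), appendZeroRow M ∈ V) :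
    ∃ c : Fin n → K,
      addLastRow c '' (V : Set (Matrix (Fin (n + 1)) (Fin n) K)) =
        bordered (Nat.le_succ n) le_rfl
          (onePlusMulAlternate (P : Matrix (Fin n) (Fin n) K)) := by
  obtain ⟨d, hd⟩ := exists_direction_correction hK hP hcodim hrank hcore
  have hP1 : ∀ M : Matrix (Fin n) (Fin n) K, P.val * ((P⁻¹ : GL (Fin n) K).val * M) = M :=
    GL.mul_inv_mul_matrix P
  have hI : appendZeroRow (1 : Matrix (Fin n) (Fin n) K) ∈ V :=
    hcore 1 ⟨0, zero_mem_alternate, by simp⟩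
  have htop : ∀ D : Matrix (Fin (n + 1)) (Fin n) K,
      dropLastRow D + vecMulVec (-(P.val *ᵥ d)) (lastRow D) =
        P.val * ((P⁻¹ : GL (Fin n) K).val * dropLastRow D - vecMulVec d (lastRow D)) := fun D => by
    rw [Matrix.mul_sub, hP1, mul_vecMulVec, neg_vecMulVec, sub_eq_add_neg]
  refine ⟨-(P.val *ᵥ d), Set.Subset.antisymm ?_ fun M hM => ?_⟩
  · rintro _ ⟨M, hM, rfl⟩
    have hD := AffineSubspace.vsub_mem_direction hM hI
    rw [vsub_eq_sub] at hD
    refine mem_bordered_iff.mpr ⟨_, hd _ hD, ?_⟩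
    rw [← htop, map_sub, map_sub, dropLastRow_appendZeroRow, lastRow_appendZeroRow,
      dropLastRow_addLastRow, sub_zero]
    abel
  · obtain ⟨A, hA, hMA⟩ := mem_bordered_iff.mp hM
    obtain ⟨D, hD, hDM⟩ := exists_direction_lastRow_eq hP hcodim hrank hcore (lastRow M)
    -- Subtracting the alternate part contributed by `D` leaves exactly `A` after the row
    -- operations.
    have hA' := add_mem_alternate hA (smul_mem_alternate (-1) (hd D hD))
    refine ⟨_, AffineSubspace.vadd_mem_of_mem_direction hD (hcore _ ⟨_, hA', rfl⟩), ?_⟩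
    refine ext_rows ?_ ?_
    · rw [vadd_eq_add, dropLastRow_addLastRow, map_add, map_add, dropLastRow_appendZeroRow,
        lastRow_appendZeroRow, add_zero, add_right_comm, htop, hMA, Matrix.mul_add,
        Matrix.mul_smul, neg_one_smul]
      abel
    · rw [vadd_eq_add, lastRow_addLastRow, map_add, lastRow_appendZeroRow, add_zero, hDM]
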